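/- Let $[s]=\{1,\dots,s\}$. An ordered chain forest of $[s]$ is a sequence $\mathcal F=\mathsf B_1\cdots\mathsf B_k$ of nonempty blocks that form a set partition of $[s]$, where each block is itself internally ordered, i.e. written as a sequence of its elements. The leader of a block is its first element; $\mathcal F$ is naturally ordered if the leaders of $\mathsf B_1,\dots,\mathsf B_k$ are increasing. The weight of a block is the number of its elements that are less than its leader, and the weight of $\mathcal F$ is the sum of the weights of its blocks. For $0\le \ell\le s-1$ let $$\gamma(\mathcal F,\ell)=\Big|\Big\{j\in\{1,\dots,k\}\;:\;\sum_{i=1}^{j}|\mathsf B_i|>\ell\Big\}\Big| .$$ For integers $a\le b+1$ and $n$, let $$\Pi^n_{a,b}=\sum_{a\le i_1<\cdots<i_n\le b} i_1\cdots i_n ,$$ the sum of all products of $n$ distinct integers in $[a,b]$, where $\Pi^0_{a,b}=1$ (also if $b=a-1$), and $\Pi^n_{a,b}=0$ if $n<0$ or $n>b-a+1$. Let $1\le m\le k\le s$, $q\ge 0$ and $0\le \ell\le s-1$ be integers, and let $\mathrm{CF}(q,s,k,\ell,m)$ be the set of naturally ordered chain forests $\mathcal F$ of $[s]$ with $k$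 blocks and weight $q$ such that $\gamma(\mathcal F,\ell)=m$. Then $$|\mathrm{CF}(q,s,k,\ell,m)|=\sum_{i=0}^{q}(-1)^i\binom{s}{i}\,\Pi^{s-\ell-m}_{-i+1,\;s-1-\ell-i}\;\Pi^{\ell-(k-m)}_{s-\ell-i,\;s-1-i}\,\binom{k-1+q-i}{k-1}.$$ -/

import Mathlib

/-- A block: a nonempty, internally ordered list of elements of `[s]`. The ground set `[s]` is
modelled by the linearly ordered set `Fin s` with `s` elements; only the order of the elements
matters. -/
@[ext]
structure ChainBlock (s : ℕ) where
  elems : List (Fin s)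
  ne_nil : elems ≠ []

namespace ChainBlock

/-- The leader of a block is its first element. -/
def leader {s : ℕ} (B : ChainBlock s) : Fin s := B.elems.head B.ne_nil

/-- The number of elements of a block. -/
def size {s : ℕ} (B : ChainBlock s) : ℕ := B.elems.length

/-- The weight of a block is the number of its elements that are less than its leader. -/
def weight {s : ℕ} (B : ChainBlock s) : ℕ := (B.elems.filter (fun x => x < B.leader)).length

end ChainBlock

/-- An ordered chain forest of `[s]`: an ordered partition of `[s]` into nonempty blocks, each of
which is internally ordered. Every element of `[s]` occurs exactly once in exactly one block. -/
@[ext]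
structure OrderedChainForest (s : ℕ) where
  blocks : List (ChainBlock s)
  nodup : (blocks.flatMap ChainBlock.elems).Nodup
  covers : ∀ x : Fin s, x ∈ blocks.flatMap ChainBlock.elems

namespace OrderedChainForest

/-- The number of blocks. -/
def numBlocks {s : ℕ} (F : OrderedChainForest s) : ℕ := F.blocks.length

/-- The blocks are ordered increasingly according to their leaders. -/
def NaturallyOrdered {s : ℕ} (F : OrderedChainForest s) : Prop :=
  F.blocks.Pairwise (fun B C => B.leader < C.leader)

/-- The weight of an ordered chain forest is the sum of the weights of its blocks. -/
def weight {s : ℕ} (F : OrderedChainForest s) : ℕ := (F.blocks.map ChainBlock.weight).sum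

/-- `γ(F, ℓ)`: the number of `j ∈ {1, …, k}` with `|B₁| + ⋯ + |B_j| > ℓ`, where
`F = B₁ ⋯ B_k`. -/
def gamma {s : ℕ} (F : OrderedChainForest s) (l : ℕ) : ℕ :=
  ((Finset.Icc 1 F.numBlocks).filter
    (fun j => l < ((F.blocks.take j).map ChainBlock.size).sum)).card

/-- There are only finitely many ordered chain forests of `[s]`. -/
instance finite (s : ℕ) : Finite (OrderedChainForest s) := by
  have hlen : ∀ F : OrderedChainForest s,
      (F.blocks.flatMap ChainBlock.elems).length = s := by
    intro F
    have h := List.toFinset_card_of_nodup F.nodup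
    have h2 : (F.blocks.flatMap ChainBlock.elems).toFinset = Finset.univ := by
      ext x
      simpa using F.covers x
    rw [← h, h2, Finset.card_univ, Fintype.card_fin]
  have hB : Finite {B : ChainBlock s // B.elems.length ≤ s} := by
    have := (List.finite_length_le (Fin s) s).to_subtype
    refine Finite.of_injective
      (fun B => (⟨B.1.elems, B.2⟩ : {l : List (Fin s) | l.length ≤ s})) ?_
    intro B C h
    exact Subtype.ext (ChainBlock.ext (congrArg Subtype.val h))
  have hsmall : ∀ F : OrderedChainForest s, ∀ B ∈ F.blocks, B.elems.length ≤ s := by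
    intro F B hBF
    have h := List.le_sum_of_mem (List.mem_map_of_mem (f := fun C => C.elems.length) hBF)
    rw [← List.length_flatMap, hlen F] at h
    exact h
  have hcount : ∀ F : OrderedChainForest s, F.blocks.length ≤ s := by
    intro F
    have h : (F.blocks.map (fun B => B.elems.length)).length ≤
        (F.blocks.map (fun B => B.elems.length)).sum := by
      refine List.length_le_sum_of_one_le _ ?_
      intro n hn
      obtain ⟨B, -, rfl⟩ := List.mem_map.1 hn
      exact List.length_pos_iff.2 B.ne_nil
    rw [List.length_map, ← List.length_flatMap, hlen F] at h
    exact h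
  have := (List.finite_length_le {B : ChainBlock s // B.elems.length ≤ s} s).to_subtype
  refine Finite.of_injective
    (fun F => (⟨F.blocks.attach.map (fun B => ⟨B.1, hsmall F B.1 B.2⟩),
        by simpa using hcount F⟩ :
      {l : List {B : ChainBlock s // B.elems.length ≤ s} | l.length ≤ s})) ?_
  intro F G h
  have h' := congrArg (List.map Subtype.val) (congrArg Subtype.val h)
  simp only [List.map_map, Function.comp_def, List.attach_map_subtype_val] at h'
  exact OrderedChainForest.ext h'

end OrderedChainForest

/-- `CF q s k l m`: the set of naturally ordered chain forests `F` of `[s]` with `k` blocks,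
weight `q` and `γ(F, l) = m`. -/
def CF (q s k l m : ℕ) : Set (OrderedChainForest s) :=
  {F | F.NaturallyOrdered ∧ F.numBlocks = k ∧ F.weight = q ∧ F.gamma l = m}

/-- `intervalESymm a b n` is `Π^n_{a,b}`: the sum of all products `i₁ ⋯ i_n` of integers
`a ≤ i₁ < ⋯ < i_n ≤ b`, and `0` for `n < 0`. It is `1` for `n = 0` (also for the empty interval
`b = a - 1`) and `0` if `n` exceeds the number of integers in `[a, b]`. -/
noncomputable def intervalESymm (a b n : ℤ) : ℤ :=
  if n < 0 then 0 else ∑ t ∈ (Finset.Icc a b).powersetCard n.toNat, ∏ x ∈ t, x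

/-! Fix the block sizes `n j + 1` first and give every position of the word an independent uniform
value in [0,1]; each relative order has probability 1/s!. If the leader of a block has value u, each
of its nonleaders contributes X when smaller and 1 when larger, so the block contributes
(1-(1-X)u)^(n j). Substituting v = 1-(1-X)u turns the increasing leaders into X < v_{k-1} < ⋯ < v_0
< 1, whence (1-X)^k ∑ X^weight = s! ∫ ∏ v_j^(n j), the sum being over naturally ordered forests with
these sizes (`sum_forests_of_sizes`).

Integrating one variable at a time gives the coefficient of X^i on the right: (-1)^i binom(s,i) ∏ (p
- i), over the nonleader positions p counted from the end of the word. Dividing by (1-X)^k produces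
the factor binom(k-1+q-i, k-1) (`card_forests_of_sizes`).

The formal proof uses no integration. `leaderPoly` is defined by its coefficients and characterised
by its derivative and its vanishing at 1. The integral formula is replaced by a recursion on partial
fillings that removes the position with the largest value; it closes because of the Euler relation
`leaderPoly_euler`.

Finally one sums over block sizes. Position s from the end always holds a leader. The condition γ =
m says that exactly m-1 of the positions 1, …, s-ℓ-1 hold leaders, which leaves k-m leaders among
s-ℓ, …, s-1. Choosing the nonleaders independently in the two ranges gives the product of two
elementary symmetric sums (`sum_nonleaderProdList`). -/

/-! ### Iterated integrals attached to block sizes, as polynomials -/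

/-- For consecutive blocks with `n 0, …, n (r - 1)` elements besides the leader, the product of
`j - i` over those positions `j` (counted from the end of the word) that hold no leader. -/
def nonleaderProd (n : ℕ → ℕ) : ℕ → ℤ → ℤ
  | 0, _ => 1
  | r + 1, i => (∏ y ∈ Finset.range (n r), ((y : ℤ) + 1 - i)) * nonleaderProd n r (i - (n r + 1))

/-- The number of elements in the first `r` blocks. -/
def blockTotal (n : ℕ → ℕ) (r : ℕ) : ℕ := ∑ j ∈ Finset.range r, (n j + 1)

theorem blockTotal_succ (n : ℕ → ℕ) (r : ℕ) :
    blockTotal n (r + 1) = blockTotal n r + (n r + 1) := Finset.sum_range_succ _ _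

theorem blockTotal_eq (n : ℕ → ℕ) (r : ℕ) :
    blockTotal n r = r + ∑ j ∈ Finset.range r, n j := by
  simp [blockTotal, Finset.sum_add_distrib, add_comm]

theorem nonleaderProd_congr {n n' : ℕ → ℕ} {r : ℕ} (h : ∀ j < r, n j = n' j) (i : ℤ) :
    nonleaderProd n r i = nonleaderProd n' r i := by
  induction r generalizing i with
  | zero => rfl
  | succ r ih =>
    simp only [nonleaderProd, h r (Nat.lt_succ_self r)]
    rw [ih fun j hj => h j (hj.trans (Nat.lt_succ_self r))]

theorem blockTotal_congr {n n' : ℕ → ℕ} {r : ℕ} (h : ∀ j < r, n j = n' j) :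
    blockTotal n r = blockTotal n' r :=
  Finset.sum_congr rfl fun j hj => by rw [h j (Finset.mem_range.1 hj)]

-- Each nonleader contributes one factor linear in `i`. The degree bound makes a high finite
-- difference vanish in `eval_one_leaderPoly_succ`.
open Polynomial in
theorem exists_polynomial_nonleaderProd (n : ℕ → ℕ) (r : ℕ) :
    ∃ P : ℤ[X], P.natDegree ≤ ∑ j ∈ Finset.range r, n j ∧
      ∀ i, P.eval i = nonleaderProd n r i := by
  induction r with
  | zero => exact ⟨1, by simp, fun i => by simp [nonleaderProd]⟩
  | succ r ih =>
    obtain ⟨P, hP, hPe⟩ := ih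
    refine ⟨(∏ y ∈ Finset.range (n r), (C ((y : ℤ) + 1) - X)) * P.comp (X - C ((n r : ℤ) + 1)),
      ?_, fun i => ?_⟩
    · refine natDegree_mul_le.trans ?_
      rw [Finset.sum_range_succ, add_comm]
      refine add_le_add ?_ ?_
      · rw [natDegree_comp, natDegree_X_sub_C, mul_one]
        exact hP
      · refine (natDegree_prod_le _ _).trans ?_
        refine (Finset.sum_le_card_nsmul _ _ 1 fun y _ => ?_).trans (by simp)
        exact (natDegree_sub_le _ _).trans
          (max_le ((natDegree_C _).le.trans zero_le_one) natDegree_X_le)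
    · rw [eval_mul, eval_comp, hPe, eval_prod]
      simp [nonleaderProd]

-- The factors are -(n+d), …, -(d+1).
open Nat in
theorem prod_range_sub_mul_factorial (n d : ℕ) :
    (∏ y ∈ Finset.range n, ((y : ℤ) + 1 - ((n : ℤ) + d + 1))) * (d ! : ℤ)
      = (-1) ^ n * ((n + d)! : ℤ) := by
  induction n with
  | zero => simp
  | succ n ih =>
    rw [Finset.prod_range_succ']
    have : ∀ y ∈ Finset.range n, (((y + 1 : ℕ) : ℤ) + 1 - (((n + 1 : ℕ) : ℤ) + d + 1))
        = (y : ℤ) + 1 - ((n : ℤ) + d + 1) := fun y _ => by push_cast; ring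
    rw [Finset.prod_congr rfl this, mul_right_comm, ih, show n + 1 + d = (n + d) + 1 by ring,
      Nat.factorial_succ]
    push_cast
    ring

open Nat in
/-- The coefficients of `leaderPoly`. -/
noncomputable def leaderCoeff (n : ℕ → ℕ) (r i : ℕ) : ℚ :=
  if i ≤ blockTotal n r then
    (-1) ^ i * (nonleaderProd n r i : ℚ) / ((i ! : ℚ) * ((blockTotal n r - i)! : ℚ)) else 0

open Polynomial in
/-- The polynomial `∫_{X < v_{r-1} < ⋯ < v_0 < 1} ∏ v_j ^ (n j)`, given by its coefficients. -/
noncomputable def leaderPoly (n : ℕ → ℕ) (r : ℕ) : ℚ[X] :=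
  ∑ i ∈ Finset.range (blockTotal n r + 1), C (leaderCoeff n r i) * X ^ i

theorem leaderPoly_congr {n n' : ℕ → ℕ} {r : ℕ} (h : ∀ j < r, n j = n' j) :
    leaderPoly n r = leaderPoly n' r := by
  simp only [leaderPoly, leaderCoeff, blockTotal_congr h, nonleaderProd_congr h]

theorem coeff_leaderPoly (n : ℕ → ℕ) (r i : ℕ) :
    (leaderPoly n r).coeff i = leaderCoeff n r i := by
  simp only [leaderPoly, Polynomial.finsetSum_coeff, Polynomial.coeff_C_mul,
    Polynomial.coeff_X_pow, mul_ite, mul_one, mul_zero]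
  rw [Finset.sum_ite_eq]
  split_ifs with h
  · rfl
  · rw [leaderCoeff, if_neg (by simpa [Nat.lt_succ_iff] using h)]

theorem leaderPoly_zero (n : ℕ → ℕ) : leaderPoly n 0 = 1 := by
  simp [leaderPoly, leaderCoeff, blockTotal, nonleaderProd]

-- With `leaderCoeff_succ_of_lt`, this is the derivative formula read coefficientwise: the factors
-- of the last block form a quotient of factorials that turns (n r + d + 1)! into d!.
open Nat in
theorem leaderCoeff_succ_add (n : ℕ → ℕ) (r d : ℕ) :
    leaderCoeff n (r + 1) (n r + d + 1) * ((n r + d : ℕ) + 1) = -leaderCoeff n r d := by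
  unfold leaderCoeff
  rw [blockTotal_succ]
  by_cases h : d ≤ blockTotal n r
  · rw [if_pos h, if_pos (by omega), show blockTotal n r + (n r + 1) - (n r + d + 1)
      = blockTotal n r - d by omega]
    have key := prod_range_sub_mul_factorial (n r) d
    have h1 : nonleaderProd n (r + 1) ((n r + d + 1 : ℕ) : ℤ)
        = (∏ y ∈ Finset.range (n r), ((y : ℤ) + 1 - ((n r : ℤ) + d + 1)))
          * nonleaderProd n r d := by
      rw [nonleaderProd]
      push_cast
      congr 2
      ring
    rw [h1]
    set A := ∏ y ∈ Finset.range (n r), ((y : ℤ) + 1 - ((n r : ℤ) + d + 1))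
    have key' : (A : ℚ) * (d ! : ℚ) = (-1) ^ n r * ((n r + d)! : ℚ) := by exact_mod_cast key
    have hd : (d ! : ℚ) ≠ 0 := by positivity
    have hA : (A : ℚ) = (-1) ^ n r * ((n r + d)! : ℚ) / (d ! : ℚ) := by
      rw [eq_div_iff hd, key']
    have hs : ((-1 : ℚ) ^ n r) * (-1) ^ n r = 1 := by
      rw [← mul_pow]; simp
    push_cast
    rw [hA, Nat.factorial_succ]
    push_cast
    have h2 : ((n r + d)! : ℚ) ≠ 0 := by positivity
    have h3 : ((blockTotal n r - d)! : ℚ) ≠ 0 := by positivity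
    have h4 : (n r : ℚ) + d + 1 ≠ 0 := by positivity
    field_simp
    rw [pow_add, pow_add]
    linear_combination (-(-1) ^ d * (nonleaderProd n r d : ℚ)) * hs
  · rw [if_neg h, if_neg (by omega)]
    simp

theorem leaderCoeff_succ_of_lt (n : ℕ → ℕ) (r i : ℕ) (h : i < n r) :
    leaderCoeff n (r + 1) (i + 1) = 0 := by
  have : nonleaderProd n (r + 1) ((i + 1 : ℕ) : ℤ) = 0 := by
    rw [nonleaderProd, Finset.prod_eq_zero (Finset.mem_range.2 h) (by push_cast; ring), zero_mul]
  rw [leaderCoeff, this]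
  simp

-- For the iterated integral this is the fundamental theorem of calculus: `X` is the lower limit of
-- the last variable.
open Polynomial in
theorem derivative_leaderPoly_succ (n : ℕ → ℕ) (r : ℕ) :
    derivative (leaderPoly n (r + 1)) = -(X ^ n r * leaderPoly n r) := by
  ext i
  rw [coeff_derivative, coeff_leaderPoly, coeff_neg, coeff_X_pow_mul', coeff_leaderPoly]
  split_ifs with h
  · obtain ⟨d, rfl⟩ := Nat.exists_eq_add_of_le h
    rw [leaderCoeff_succ_add, Nat.add_sub_cancel_left]
  · rw [leaderCoeff_succ_of_lt _ _ _ (not_le.1 h)]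
    simp

theorem sum_neg_one_pow_choose_mul_eval_eq_zero (P : Polynomial ℤ) {s : ℕ}
    (h : P.natDegree < s) :
    ∑ i ∈ Finset.range (s + 1), (-1 : ℤ) ^ i * (s.choose i : ℤ) * P.eval (i : ℤ) = 0 := by
  have h1 := congrFun (Polynomial.fwdDiff_iter_eq_zero_of_degree_lt h) 0
  rw [fwdDiff_iter_eq_sum_shift] at h1
  have h2 : ∑ i ∈ Finset.range (s + 1), (-1 : ℤ) ^ i * (s.choose i : ℤ) * P.eval (i : ℤ)
      = (-1) ^ s * ∑ k ∈ Finset.range (s + 1),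
        ((-1 : ℤ) ^ (s - k) * s.choose k) • P.eval (0 + k • (1 : ℤ)) := by
    rw [Finset.mul_sum]
    refine Finset.sum_congr rfl fun i hi => ?_
    have hi' : i ≤ s := Nat.lt_succ_iff.1 (Finset.mem_range.1 hi)
    have h3 : (-1 : ℤ) ^ s * (-1) ^ (s - i) = (-1) ^ i := by
      obtain ⟨d, rfl⟩ := Nat.exists_eq_add_of_le hi'
      rw [Nat.add_sub_cancel_left, pow_add, mul_assoc, ← mul_pow]
      simp
    simp only [nsmul_eq_mul, mul_one, zero_add, smul_eq_mul]
    rw [← mul_assoc, ← mul_assoc, h3]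
  rw [h2, h1]
  simp

open Nat in
theorem leaderCoeff_mul_factorial (n : ℕ → ℕ) (r i : ℕ) :
    ((blockTotal n r)! : ℚ) * leaderCoeff n r i
      = (-1) ^ i * ((blockTotal n r).choose i : ℚ) * (nonleaderProd n r i : ℚ) := by
  unfold leaderCoeff
  split_ifs with h
  · rw [Nat.cast_choose ℚ h]
    ring
  · rw [Nat.choose_eq_zero_of_lt (not_le.1 h)]
    simp

-- The domain of integration collapses at X = 1. Algebraically, the value is up to a factorial a
-- finite difference of order `blockTotal n (r + 1)`, which exceeds the degree by the number of
-- leaders.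
open Polynomial Nat in
theorem eval_one_leaderPoly_succ (n : ℕ → ℕ) (r : ℕ) : (leaderPoly n (r + 1)).eval 1 = 0 := by
  obtain ⟨P, hP, hPe⟩ := exists_polynomial_nonleaderProd n (r + 1)
  have h := sum_neg_one_pow_choose_mul_eval_eq_zero P (s := blockTotal n (r + 1))
    (by rw [blockTotal_eq]; omega)
  have h2 : ((blockTotal n (r + 1))! : ℚ) * (leaderPoly n (r + 1)).eval 1 = 0 := by
    rw [leaderPoly, eval_finsetSum, Finset.mul_sum]
    simp only [eval_mul, eval_C, eval_pow, eval_X, one_pow, mul_one, leaderCoeff_mul_factorial]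
    simp only [hPe] at h
    exact_mod_cast h
  exact (mul_eq_zero.1 h2).resolve_left (by positivity)

open Polynomial in
theorem eq_of_derivative_eq_of_eval_eq {P Q : ℚ[X]} (h : derivative P = derivative Q)
    (h1 : P.eval 1 = Q.eval 1) : P = Q := by
  have h2 : derivative (P - Q) = 0 := by rw [derivative_sub, h, sub_self]
  have h3 := eq_C_of_derivative_eq_zero h2
  have h4 : (P - Q).eval 1 = 0 := by rw [eval_sub, h1, sub_self]
  rw [h3, eval_C] at h4
  rw [h4, C_0] at h3
  exact sub_eq_zero.1 h3

-- Dilation about the point 1: put v_j = 1 - t u_j with t = 1 - X and apply t d/dt to the integral.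
-- The volume element gives r, and each v_j^(n j) gives n j (v_j^(n j) - v_j^(n j - 1)). The proof
-- checks this by induction, comparing derivatives and values at 1.
open Polynomial in
theorem leaderPoly_euler (n : ℕ → ℕ) (r : ℕ) :
    (blockTotal n r : ℚ[X]) * leaderPoly n r
      - ∑ j ∈ Finset.range r, (n j : ℚ[X]) * leaderPoly (Function.update n j (n j - 1)) r
      = -((1 - X) * derivative (leaderPoly n r)) := by
  induction r with
  | zero => simp [leaderPoly_zero, blockTotal]
  | succ r ih =>
    apply eq_of_derivative_eq_of_eval_eq
    · have hlast : leaderPoly (Function.update n r (n r - 1)) r = leaderPoly n r :=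
        leaderPoly_congr fun j hj => Function.update_of_ne hj.ne _ _
      -- If `n r = 0` the exponent truncates, but the factor `n r` kills the term.
      have hpow : (n r : ℚ[X]) * X ^ (n r - 1) * X = (n r : ℚ[X]) * X ^ n r := by
        cases n r with
        | zero => simp
        | succ a => simp [pow_succ, mul_assoc]
      have hsum : ∑ j ∈ Finset.range r,
          derivative ((n j : ℚ[X]) * leaderPoly (Function.update n j (n j - 1)) (r + 1))
          = -(X ^ n r * ∑ j ∈ Finset.range r,
            (n j : ℚ[X]) * leaderPoly (Function.update n j (n j - 1)) r) := by
        rw [Finset.mul_sum, ← Finset.sum_neg_distrib]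
        refine Finset.sum_congr rfl fun j hj => ?_
        rw [derivative_mul, derivative_natCast, derivative_leaderPoly_succ,
          Function.update_of_ne (Finset.mem_range.1 hj).ne']
        ring
      rw [Finset.sum_range_succ, derivative_sub, derivative_add, derivative_sum, hsum,
        derivative_mul, derivative_mul, derivative_natCast, derivative_natCast,
        derivative_leaderPoly_succ, derivative_leaderPoly_succ, Function.update_self, hlast,
        derivative_neg, derivative_mul, derivative_neg, derivative_mul, derivative_X_pow,
        blockTotal_succ]
      simp only [derivative_sub, derivative_one, derivative_X, map_natCast]
      push_cast
      linear_combination (-X ^ n r) * ih + leaderPoly n r * hpow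
    · rw [eval_sub, eval_finsetSum]
      simp [eval_one_leaderPoly_succ]

open Polynomial in
theorem blockTotal_mul_leaderPoly_succ (n : ℕ → ℕ) (r : ℕ) :
    (blockTotal n (r + 1) : ℚ[X]) * leaderPoly n (r + 1)
      = ∑ j ∈ Finset.range (r + 1),
          (n j : ℚ[X]) * leaderPoly (Function.update n j (n j - 1)) (r + 1)
        + (1 - X) * X ^ n r * leaderPoly n r := by
  have h := leaderPoly_euler n (r + 1)
  rw [derivative_leaderPoly_succ] at h
  linear_combination h

/-! ### Sums over linear orders by removal of the last element -/

/-- The weight of an injective enumeration `f`, where `w p S` is the weight of adding `p` to the set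
`S` of elements enumerated before it. -/
noncomputable def enumWeight {α R : Type*} [DecidableEq α] [CommRing R] (w : α → Finset α → R)
    {m : ℕ} (f : Fin m → α) : R :=
  ∏ i, if f i ∈ (Finset.univ.filter (· < i)).image f then 0
    else w (f i) ((Finset.univ.filter (· < i)).image f)

theorem enumWeight_snoc {α R : Type*} [DecidableEq α] [CommRing R] (w : α → Finset α → R)
    {m : ℕ} (g : Fin m → α) (p : α) :
    enumWeight w (Fin.snoc g p : Fin (m + 1) → α)
      = enumWeight w g * if p ∈ Finset.univ.image g then 0 else w p (Finset.univ.image g) := by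
  have h1 : ∀ i : Fin m, (Finset.univ.filter (· < i.castSucc)).image
      (Fin.snoc g p : Fin (m + 1) → α) = (Finset.univ.filter (· < i)).image g := by
    intro i
    ext a
    simp only [Finset.mem_image, Finset.mem_filter, Finset.mem_univ, true_and]
    constructor
    · rintro ⟨j, hj, rfl⟩
      refine ⟨j.castPred (ne_of_lt (hj.trans (Fin.castSucc_lt_last i))), ?_, ?_⟩
      · simpa [Fin.lt_def] using hj
      · conv_rhs => rw [← Fin.castSucc_castPred j (ne_of_lt (hj.trans (Fin.castSucc_lt_last i)))]
        rw [Fin.snoc_castSucc]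
    · rintro ⟨j, hj, rfl⟩
      exact ⟨j.castSucc, by simpa using hj, by simp⟩
  have h2 : (Finset.univ.filter (· < Fin.last m)).image (Fin.snoc g p : Fin (m + 1) → α)
      = Finset.univ.image g := by
    ext a
    simp only [Finset.mem_image, Finset.mem_filter, Finset.mem_univ, true_and]
    constructor
    · rintro ⟨j, hj, rfl⟩
      refine ⟨j.castPred hj.ne, ?_⟩
      conv_rhs => rw [← Fin.castSucc_castPred j hj.ne]
      rw [Fin.snoc_castSucc]
    · rintro ⟨j, rfl⟩
      exact ⟨j.castSucc, Fin.castSucc_lt_last j, by simp⟩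
  rw [enumWeight, Fin.prod_univ_castSucc]
  simp only [h1, h2, Fin.snoc_castSucc, Fin.snoc_last]
  rfl

theorem image_snoc {α : Type*} [DecidableEq α] {m : ℕ} (g : Fin m → α) (p : α) :
    Finset.univ.image (Fin.snoc g p : Fin (m + 1) → α) = insert p (Finset.univ.image g) := by
  ext a
  simp only [Finset.mem_image, Finset.mem_univ, true_and, Finset.mem_insert, Fin.exists_fin_succ',
    Fin.snoc_castSucc, Fin.snoc_last]
  tauto

/-- Split off the last entry p of an enumeration of S. Functions with a repeated value have weight
0, so the sum may run over all functions. -/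
theorem sum_enumWeight {α R : Type*} [Fintype α] [DecidableEq α] [CommRing R]
    (w : α → Finset α → R) (Φ : Finset α → R) (h0 : Φ ∅ = 1)
    (h : ∀ S : Finset α, S.Nonempty → Φ S = ∑ p ∈ S, w p (S.erase p) * Φ (S.erase p))
    (m : ℕ) (S : Finset α) (hS : S.card = m) :
    ∑ f : Fin m → α, (if Finset.univ.image f = S then enumWeight w f else 0) = Φ S := by
  induction m generalizing S with
  | zero =>
    rw [Finset.card_eq_zero] at hS
    subst hS
    simp [h0, enumWeight]
  | succ m ih =>
    rw [← (Fin.snocEquiv fun _ : Fin (m + 1) => α).sum_comp, Fintype.sum_prod_type,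
      h S (Finset.card_pos.1 (by omega)), ← Finset.sum_subset (Finset.subset_univ S)]
    · refine Finset.sum_congr rfl fun p hp => ?_
      rw [← ih (S.erase p) (by rw [Finset.card_erase_of_mem hp, hS]; rfl), Finset.mul_sum]
      refine Finset.sum_congr rfl fun g _ => ?_
      change (if Finset.univ.image (Fin.snoc g p : Fin (m + 1) → α) = S
        then enumWeight w (Fin.snoc g p : Fin (m + 1) → α) else 0) = _
      rw [image_snoc, enumWeight_snoc]
      by_cases hpg : p ∈ Finset.univ.image g
      · have : Finset.univ.image g ≠ S.erase p := fun he => by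
          rw [he] at hpg
          simp at hpg
        rw [if_neg this]
        simp only [if_pos hpg]
        simp
      · by_cases he : Finset.univ.image g = S.erase p
        · rw [if_pos he, if_neg hpg, if_pos (by rw [he, Finset.insert_erase hp]), he, mul_comm]
        · rw [if_neg he, if_neg, mul_zero]
          intro hins
          apply he
          rw [← hins, Finset.erase_insert hpg]
    · intro p _ hp
      refine Finset.sum_eq_zero fun g _ => ?_
      change (if Finset.univ.image (Fin.snoc g p : Fin (m + 1) → α) = S
        then enumWeight w (Fin.snoc g p : Fin (m + 1) → α) else 0) = _
      rw [image_snoc, if_neg]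
      intro hins
      exact hp (hins ▸ Finset.mem_insert_self _ _)

/-- The inverse of `e` is an enumeration, and the entries preceding p are those with smaller `e`. -/
theorem sum_equiv_prod_weight {α R : Type*} [Fintype α] [DecidableEq α] [CommRing R]
    (w : α → Finset α → R) (Φ : Finset α → R) (h0 : Φ ∅ = 1)
    (h : ∀ S : Finset α, S.Nonempty → Φ S = ∑ p ∈ S, w p (S.erase p) * Φ (S.erase p))
    (m : ℕ) (hm : Fintype.card α = m) :
    ∑ e : α ≃ Fin m, ∏ p, w p (Finset.univ.filter fun p' => e p' < e p) = Φ Finset.univ := by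
  rw [← sum_enumWeight w Φ h0 h m Finset.univ (by rw [Finset.card_univ, hm]), ← Finset.sum_filter]
  refine Finset.sum_bij (fun e _ => e.symm) ?_ ?_ ?_ ?_
  · intro e _
    simp [Finset.image_univ_equiv]
  · intro e _ e' _ hee
    exact Equiv.symm_bijective.injective (DFunLike.coe_injective hee)
  · intro f hf
    have hs : Function.Surjective f := fun a => by
      have : a ∈ Finset.univ.image f := by rw [(Finset.mem_filter.1 hf).2]; simp
      simpa using this
    have hbij : Function.Bijective f :=
      (Fintype.bijective_iff_surjective_and_card f).2 ⟨hs, by simp [hm]⟩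
    exact ⟨(Equiv.ofBijective f hbij).symm, Finset.mem_univ _, by ext; simp⟩
  · intro e _
    rw [enumWeight, ← e.prod_comp]
    refine Finset.prod_congr rfl fun p _ => ?_
    have : (Finset.univ.filter (· < e p)).image e.symm
        = Finset.univ.filter fun p' => e p' < e p := by
      ext a
      simp only [Finset.mem_image, Finset.mem_filter, Finset.mem_univ, true_and]
      exact ⟨by rintro ⟨i, hi, rfl⟩; simpa using hi, fun ha => ⟨e a, ha, by simp⟩⟩
    rw [this, if_neg (by simp)]
    simp

/-! ### Filling the positions in increasing order of value -/

section Fill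

variable {k : ℕ} {α : Type*} [DecidableEq α] (b : α → Fin k) (lead : Fin k → α)

/-- The number of elements of `S` in block `j` that are not the leader. -/
def nonleaderCount (S : Finset α) (j : ℕ) : ℕ :=
  (S.filter fun p => (b p : ℕ) = j ∧ p ≠ lead (b p)).card

open Polynomial in
/-- The weight of filling position `p` when exactly the positions in `S` hold smaller values. -/
noncomputable def fillWeight (p : α) (S : Finset α) : ℚ[X] :=
  if p = lead (b p) then (if ∀ j < b p, lead j ∈ S then 1 - X else 0)
  else if lead (b p) ∈ S then 1 else X

open Polynomial Nat in
/-- The total weight of all orders in which the positions in `S` can be filled. -/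
noncomputable def fillSum (S : Finset α) : ℚ[X] :=
  if ∀ j, lead j ∈ S ↔ (j : ℕ) < (Finset.univ.filter fun j => lead j ∈ S).card then
    (S.card ! : ℚ[X])
      * X ^ (S.filter fun p => p ≠ lead (b p)
          ∧ (Finset.univ.filter fun j => lead j ∈ S).card ≤ (b p : ℕ)).card
      * leaderPoly (nonleaderCount b lead S) (Finset.univ.filter fun j => lead j ∈ S).card
  else 0

open Polynomial Nat in
theorem fillSum_of_prefix {S : Finset α} {r : ℕ} (hr : r ≤ k)
    (h : ∀ j, lead j ∈ S ↔ (j : ℕ) < r) :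
    fillSum b lead S = (S.card ! : ℚ[X])
      * X ^ (S.filter fun p => p ≠ lead (b p) ∧ r ≤ (b p : ℕ)).card
      * leaderPoly (nonleaderCount b lead S) r := by
  have hc : (Finset.univ.filter fun j => lead j ∈ S).card = r := by
    simp only [h]
    rw [Fin.card_filter_val_lt, min_eq_right hr]
  rw [fillSum, hc, if_pos h]

theorem fillSum_of_not_prefix {S : Finset α}
    (h : ∀ r ≤ k, ¬ ∀ j, lead j ∈ S ↔ (j : ℕ) < r) : fillSum b lead S = 0 := by
  rw [fillSum, if_neg]
  exact h _ ((Finset.card_le_univ _).trans (by simp))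

theorem fillSum_empty : fillSum b lead ∅ = 1 := by
  rw [fillSum_of_prefix b lead (Nat.zero_le k) (by simp)]
  simp [leaderPoly_zero]

variable {b lead}

theorem nonleaderCount_erase {S : Finset α} {p : α} (hp : p ∈ S) (hpl : p ≠ lead (b p)) :
    nonleaderCount b lead (S.erase p) = Function.update (nonleaderCount b lead S) (b p)
      (nonleaderCount b lead S (b p) - 1) := by
  funext j
  unfold nonleaderCount
  rw [Finset.filter_erase]
  by_cases hj : j = (b p : ℕ)
  · subst hj
    rw [Function.update_self, Finset.card_erase_of_mem (by simp [hp, hpl])]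
  · rw [Function.update_of_ne hj, Finset.erase_eq_of_notMem]
    simp only [Finset.mem_filter, not_and]
    exact fun _ h => absurd h.symm hj

theorem nonleaderCount_erase_leader {S : Finset α} {p : α} (hpl : p = lead (b p)) :
    nonleaderCount b lead (S.erase p) = nonleaderCount b lead S := by
  funext j
  unfold nonleaderCount
  rw [Finset.filter_erase, Finset.erase_eq_of_notMem]
  simp only [Finset.mem_filter, not_and, not_not]
  exact fun _ _ => hpl

theorem sum_nonleaders {R : Type*} [CommSemiring R] (S : Finset α) (r : ℕ) (h : ℕ → R) (c : R) :
    ∑ p ∈ S with p ≠ lead (b p), (if (b p : ℕ) < r then h (b p) else c)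
      = ∑ j ∈ Finset.range r, (nonleaderCount b lead S j : R) * h j
        + ((S.filter fun p => p ≠ lead (b p) ∧ r ≤ (b p : ℕ)).card : R) * c := by
  rw [Finset.sum_ite, Finset.sum_const, nsmul_eq_mul, Finset.filter_filter, Finset.filter_filter]
  congr 1
  · rw [← Finset.sum_fiberwise_of_maps_to (t := Finset.range r) (g := fun p => (b p : ℕ))]
    · refine Finset.sum_congr rfl fun j hj => ?_
      have hj' := Finset.mem_range.1 hj
      rw [Finset.sum_congr rfl (g := fun _ => h j), Finset.sum_const, nsmul_eq_mul,
        Finset.filter_filter, nonleaderCount]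
      · congr 3
        ext p
        simp only [Finset.mem_filter]
        constructor
        · rintro ⟨h1, h2, h3⟩
          exact ⟨h1, h3, h2.1⟩
        · rintro ⟨h1, h2, h3⟩
          exact ⟨h1, ⟨h3, h2 ▸ hj'⟩, h2⟩
      · intro p hp
        rw [(Finset.mem_filter.1 hp).2]
    · intro p hp
      simpa using (Finset.mem_filter.1 hp).2.2
  · simp only [not_lt]

/-- S consists of r leaders, the nonleaders in the first r blocks, and the nonleaders in later
blocks, whose leaders are still missing. -/
theorem card_eq_blockTotal_add (hb : ∀ j, b (lead j) = j) {S : Finset α} {r : ℕ} (hr : r ≤ k)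
    (h : ∀ j, lead j ∈ S ↔ (j : ℕ) < r) :
    S.card = blockTotal (nonleaderCount b lead S) r
      + (S.filter fun p => p ≠ lead (b p) ∧ r ≤ (b p : ℕ)).card := by
  have h1 : (S.filter fun p => p = lead (b p)).card = r := by
    have hr' : (Finset.univ.filter fun j : Fin k => (j : ℕ) < r).card = r := by
      rw [Fin.card_filter_val_lt, min_eq_right hr]
    refine Eq.trans (Eq.symm ?_) hr'
    refine Finset.card_bij (fun j _ => lead j) ?_ ?_ ?_
    · intro j hj
      simp [hb, h, (Finset.mem_filter.1 hj).2]
    · intro i _ j _ hij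
      rw [← hb i, ← hb j, hij]
    · intro p hp
      obtain ⟨hpS, hpl⟩ := Finset.mem_filter.1 hp
      exact ⟨b p, by rw [hpl, h] at hpS; simpa using hpS, hpl.symm⟩
  have h2 := sum_nonleaders (b := b) (lead := lead) (R := ℕ) S r (fun _ => 1) 1
  simp only [ite_self, Finset.sum_const, smul_eq_mul, mul_one, Nat.cast_id] at h2
  have h3 := Finset.card_filter_add_card_filter_not (s := S) (fun p => p = lead (b p))
  rw [blockTotal_eq]
  simp only [ne_eq] at h2 ⊢
  omega

-- Sort by the position p filled last. The terms add up to a! X^e (N + e) P, where P = `leaderPoly n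
-- r`, N = `blockTotal n r` and N + e = a + 1; the Euler relation cancels the terms with a lowered
-- count.
open Polynomial Nat in
theorem fillSum_rec_of_prefix (hb : ∀ j, b (lead j) = j) {S : Finset α} (hS : S.Nonempty) {r : ℕ}
    (hr : r ≤ k) (h : ∀ j, lead j ∈ S ↔ (j : ℕ) < r) :
    fillSum b lead S
      = ∑ p ∈ S, fillWeight b lead p (S.erase p) * fillSum b lead (S.erase p) := by
  obtain ⟨a, ha⟩ : ∃ a, S.card = a + 1 := Nat.exists_eq_add_one.2 (Finset.card_pos.2 hS)
  set n := nonleaderCount b lead S with hn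
  set e := (S.filter fun p => p ≠ lead (b p) ∧ r ≤ (b p : ℕ)).card with he
  have hcard : a + 1 = blockTotal n r + e := by
    rw [← ha, card_eq_blockTotal_add hb hr h]
  -- A nonleader in the first r blocks has weight 1 and its removal lowers one count; any other has
  -- weight X, which restores the power X^e.
  have hnon : ∑ p ∈ S with p ≠ lead (b p),
      fillWeight b lead p (S.erase p) * fillSum b lead (S.erase p)
      = (a ! : ℚ[X]) * X ^ e * (∑ j ∈ Finset.range r,
          (n j : ℚ[X]) * leaderPoly (Function.update n j (n j - 1)) r
          + (e : ℚ[X]) * leaderPoly n r) := by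
    have h1 := sum_nonleaders (b := b) (lead := lead) S r
      (fun j => leaderPoly (Function.update n j (n j - 1)) r) (leaderPoly n r)
    rw [← hn, ← he] at h1
    rw [← h1, Finset.mul_sum]
    refine Finset.sum_congr rfl fun p hp => ?_
    obtain ⟨hpS, hpl⟩ := Finset.mem_filter.1 hp
    have hmem : ∀ j, lead j ∈ S.erase p ↔ (j : ℕ) < r := by
      intro j
      rw [Finset.mem_erase, h]
      refine and_iff_right_of_imp fun _ hj => hpl ?_
      rw [← hj, hb]
    rw [fillSum_of_prefix b lead hr hmem, fillWeight, if_neg hpl,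
      Finset.card_erase_of_mem hpS, ha, nonleaderCount_erase hpS hpl, Finset.filter_erase, ← hn]
    simp only [hmem, Nat.add_sub_cancel]
    split_ifs with hbr
    · rw [Finset.erase_eq_of_notMem (by simp; omega), ← he]
      ring
    · have hpe : p ∈ S.filter fun p => p ≠ lead (b p) ∧ r ≤ (b p : ℕ) := by
        simp only [Finset.mem_filter]
        exact ⟨hpS, hpl, not_lt.1 hbr⟩
      rw [Finset.card_erase_of_mem hpe, ← he, leaderPoly_congr (n' := n)]
      · have : 0 < e := Finset.card_pos.2 ⟨p, hpe⟩
        obtain ⟨d, hd⟩ := Nat.exists_eq_add_one.2 this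
        rw [hd, Nat.add_sub_cancel, pow_succ]
        ring
      · intro j hj
        exact Function.update_of_ne (by omega) _ _
  -- Only the last leader present can have been filled last: removing an earlier one leaves a gap.
  -- The nonleaders of its block then come before their leader, which gives (1-X) X^(n (r-1)) and
  -- lets the Euler relation apply.
  have hlead : ∑ p ∈ S with p = lead (b p),
      fillWeight b lead p (S.erase p) * fillSum b lead (S.erase p)
      = (a ! : ℚ[X]) * X ^ e * ((blockTotal n r : ℚ[X]) * leaderPoly n r
          - ∑ j ∈ Finset.range r,
            (n j : ℚ[X]) * leaderPoly (Function.update n j (n j - 1)) r) := by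
    cases r with
    | zero =>
      rw [Finset.sum_eq_zero]
      · simp [blockTotal]
      · intro p hp
        obtain ⟨hpS, hpl⟩ := Finset.mem_filter.1 hp
        rw [hpl, h] at hpS
        simp at hpS
    | succ r =>
      rw [blockTotal_mul_leaderPoly_succ]
      have hq : lead ⟨r, hr⟩ ∈ S := (h _).2 (Nat.lt_succ_self r)
      rw [Finset.sum_eq_single (lead ⟨r, hr⟩)]
      · have hql : lead ⟨r, hr⟩ = lead (b (lead ⟨r, hr⟩)) := by rw [hb]
        have hmem : ∀ j, lead j ∈ S.erase (lead ⟨r, hr⟩) ↔ (j : ℕ) < r := by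
          intro j
          rw [Finset.mem_erase, h]
          constructor
          · rintro ⟨h1, h2⟩
            refine lt_of_le_of_ne (Nat.lt_succ_iff.1 h2) fun h3 => h1 ?_
            congr 1
            exact Fin.ext h3
          · intro h1
            refine ⟨fun h2 => ?_, h1.trans (Nat.lt_succ_self r)⟩
            have := congrArg b h2
            rw [hb, hb] at this
            rw [this] at h1
            exact lt_irrefl _ h1
        have hE : ((S.erase (lead ⟨r, hr⟩)).filter
            fun p => p ≠ lead (b p) ∧ r ≤ (b p : ℕ)).card = e + n r := by
          rw [Finset.filter_erase, Finset.erase_eq_of_notMem (by simp [hb]), he, hn,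
            nonleaderCount, ← Finset.card_union_of_disjoint]
          · congr 1
            ext p
            simp only [Finset.mem_filter, Finset.mem_union]
            constructor
            · rintro ⟨h1, h2, h3⟩
              rcases h3.eq_or_lt with h4 | h4
              · exact Or.inr ⟨h1, h4.symm, h2⟩
              · exact Or.inl ⟨h1, h2, h4⟩
            · rintro (⟨h1, h2, h3⟩ | ⟨h1, h2, h3⟩)
              · exact ⟨h1, h2, by omega⟩
              · exact ⟨h1, h3, by omega⟩
          · rw [Finset.disjoint_left]
            intro p h1 h2
            simp only [Finset.mem_filter] at h1 h2
            omega
        rw [fillSum_of_prefix b lead (Nat.le_of_succ_le hr) hmem, fillWeight, if_pos hql, hb,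
          if_pos (fun j (hj : j < ⟨r, hr⟩) => (hmem j).2 hj), hE, nonleaderCount_erase_leader hql, ← hn,
          Finset.card_erase_of_mem hq, ha, Nat.add_sub_cancel, pow_add]
        ring
      · intro p hp hpq
        obtain ⟨hpS, hpl⟩ := Finset.mem_filter.1 hp
        have hbp : (b p : ℕ) < r := by
          rw [hpl, h] at hpS
          refine lt_of_le_of_ne (Nat.lt_succ_iff.1 hpS) fun h3 => hpq ?_
          rw [hpl]
          congr 1
          exact Fin.ext h3
        rw [fillSum_of_not_prefix, mul_zero]
        intro r' _ hr'
        have h1 := (hr' ⟨r, hr⟩).1 (by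
          rw [Finset.mem_erase]
          exact ⟨fun h2 => hpq h2.symm, hq⟩)
        have h2 := (hr' (b p)).2 (hbp.trans h1)
        rw [← hpl] at h2
        simp at h2
      · intro hq'
        exact absurd (Finset.mem_filter.2 ⟨hq, by rw [hb]⟩) hq'
  rw [← Finset.sum_filter_add_sum_filter_not S (fun p => p = lead (b p)), hlead]
  simp only [ne_eq] at hnon
  rw [hnon, fillSum_of_prefix b lead hr h, ← he, ← hn, ha, Nat.factorial_succ]
  have hc : ((a : ℚ[X]) + 1) = (blockTotal n r : ℚ[X]) + e := by exact_mod_cast hcard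
  push_cast
  rw [hc]
  ring

/-- If the leaders in S have a gap, every term vanishes: a removal that closes the gap must remove a
leader filled before one of its predecessors, and that has weight 0. -/
theorem fillSum_rec (hb : ∀ j, b (lead j) = j) {S : Finset α} (hS : S.Nonempty) :
    fillSum b lead S
      = ∑ p ∈ S, fillWeight b lead p (S.erase p) * fillSum b lead (S.erase p) := by
  by_cases h : ∃ r ≤ k, ∀ j, lead j ∈ S ↔ (j : ℕ) < r
  · obtain ⟨r, hr, h⟩ := h
    exact fillSum_rec_of_prefix hb hS hr h
  · have h' : ∀ r ≤ k, ¬ ∀ j, lead j ∈ S ↔ (j : ℕ) < r := fun r hr hj => h ⟨r, hr, hj⟩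
    rw [fillSum_of_not_prefix b lead h', Finset.sum_eq_zero]
    intro p hp
    by_cases h1 : ∃ r ≤ k, ∀ j, lead j ∈ S.erase p ↔ (j : ℕ) < r
    · obtain ⟨r, hr, h1⟩ := h1
      have hpl : p = lead (b p) := by
        by_contra hpl
        refine h' r hr fun j => ?_
        rw [← h1, Finset.mem_erase]
        refine (and_iff_right_of_imp fun _ hj => hpl ?_).symm
        rw [← hj, hb]
      rw [fillWeight, if_pos hpl, if_neg, zero_mul]
      intro hall
      have hr1 : r = (b p : ℕ) := by
        apply le_antisymm
        · by_contra hlt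
          have := (h1 (b p)).2 (not_le.1 hlt)
          rw [← hpl] at this
          simp at this
        · by_contra hlt
          have hlt := not_le.1 hlt
          have h2 : r < k := hlt.trans (b p).2
          have := (h1 ⟨r, h2⟩).1 (hall _ hlt)
          simp at this
      refine h' (r + 1) (hr1 ▸ (b p).2) fun j => ?_
      rw [Nat.lt_succ_iff_lt_or_eq, ← h1, Finset.mem_erase]
      constructor
      · intro hj
        by_cases hjp : lead j = p
        · right
          rw [hr1, ← hjp, hb]
        · exact Or.inl ⟨hjp, hj⟩
      · rintro (hj | hj)
        · exact hj.2
        · have : j = b p := Fin.ext (hj.trans hr1)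
          rw [this, ← hpl]
          exact hp
    · rw [fillSum_of_not_prefix b lead fun r hr hj => h1 ⟨r, hr, hj⟩, mul_zero]

open Polynomial Nat in
theorem sum_prod_fillWeight [Fintype α] (hb : ∀ j, b (lead j) = j) (s : ℕ)
    (hs : Fintype.card α = s) :
    ∑ e : α ≃ Fin s, ∏ p, fillWeight b lead p (Finset.univ.filter fun p' => e p' < e p)
      = (s ! : ℚ[X]) * leaderPoly (nonleaderCount b lead Finset.univ) k := by
  rw [sum_equiv_prod_weight _ (fillSum b lead) (fillSum_empty b lead)
    (fun S hS => fillSum_rec hb hS) s hs,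
    fillSum_of_prefix b lead le_rfl (by simp), Finset.card_univ, hs, Finset.filter_false_of_mem]
  · simp
  · rintro p - ⟨-, h⟩
    exact absurd (b p).2 (not_lt.2 h)

end Fill

/-! ### Elementary symmetric sums over compositions -/

theorem intervalESymm_of_lt {a b : ℤ} (h : b < a) (n : ℤ) :
    intervalESymm a b n = if n = 0 then 1 else 0 := by
  unfold intervalESymm
  rw [Finset.Icc_eq_empty (not_le.2 h)]
  split_ifs with h1 h2 h2
  · omega
  · rfl
  · subst h2
    simp
  · rw [Finset.powersetCard_eq_empty.2, Finset.sum_empty]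
    simp
    omega

theorem intervalESymm_rec {a b : ℤ} (h : a ≤ b) (n : ℤ) :
    intervalESymm a b n
      = intervalESymm (a + 1) b n + a * intervalESymm (a + 1) b (n - 1) := by
  have hIcc : Finset.Icc a b = insert a (Finset.Icc (a + 1) b) := by
    ext x
    simp only [Finset.mem_Icc, Finset.mem_insert]
    omega
  have ha : a ∉ Finset.Icc (a + 1) b := by simp
  unfold intervalESymm
  rcases lt_trichotomy n 0 with hn | rfl | hn
  · rw [if_pos hn, if_pos hn, if_pos (by omega)]
    simp
  · simp
  · rw [if_neg (by omega), if_neg (by omega), if_neg (by omega)]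
    obtain ⟨d, rfl⟩ : ∃ d : ℕ, n = d + 1 := ⟨(n - 1).toNat, by omega⟩
    rw [show ((d : ℤ) + 1).toNat = d + 1 by omega, show ((d : ℤ) + 1 - 1).toNat = d by omega,
      hIcc, Finset.powersetCard_succ_insert ha, Finset.sum_union, Finset.sum_image,
      Finset.mul_sum]
    · congr 1
      refine Finset.sum_congr rfl fun t ht => ?_
      rw [Finset.prod_insert fun hat => ha ((Finset.mem_powersetCard.1 ht).1 hat)]
    · intro t ht t' ht' htt
      have h1 : a ∉ t := fun hat => ha ((Finset.mem_powersetCard.1 ht).1 hat)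
      have h2 : a ∉ t' := fun hat => ha ((Finset.mem_powersetCard.1 ht').1 hat)
      rw [← Finset.erase_insert h1, ← Finset.erase_insert h2, htt]
    · rw [Finset.disjoint_left]
      intro t ht ht'
      obtain ⟨u, -, rfl⟩ := Finset.mem_image.1 ht'
      exact ha ((Finset.mem_powersetCard.1 ht).1 (Finset.mem_insert_self _ _))

/-- `nonleaderProd` for a list of nonleader counts, the last block first. -/
def nonleaderProdList : List ℕ → ℤ → ℤ
  | [], _ => 1
  | n :: L, i => (∏ y ∈ Finset.range n, ((y : ℤ) + 1 - i)) * nonleaderProdList L (i - (n + 1))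

theorem nonleaderProd_eq_list (n : ℕ → ℕ) (r : ℕ) (i : ℤ) :
    nonleaderProd n r i = nonleaderProdList ((List.range r).map n).reverse i := by
  induction r generalizing i with
  | zero => rfl
  | succ r ih =>
    rw [List.range_succ, List.map_append, List.reverse_append]
    simp [nonleaderProd, nonleaderProdList, ih]

/-- Enlarge the first block by one element. -/
def incHead : List ℕ → List ℕ
  | [] => []
  | n :: L => (n + 1) :: L

/-- The compositions of `N + 1`, with every part decreased by one. -/
def compositionLists : ℕ → Finset (List ℕ)
  | 0 => {[0]}
  | N + 1 => (compositionLists N).image (List.cons 0) ∪ (compositionLists N).image incHead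

theorem mem_compositionLists {N : ℕ} {L : List ℕ} :
    L ∈ compositionLists N ↔ (L.map (· + 1)).sum = N + 1 := by
  induction N generalizing L with
  | zero =>
    rw [compositionLists, Finset.mem_singleton]
    constructor
    · rintro rfl
      rfl
    · intro h
      match L, h with
      | n :: [], h =>
        simp at h
        simp [h]
      | n :: n' :: L, h =>
        simp at h
        omega
  | succ N ih =>
    rw [compositionLists, Finset.mem_union, Finset.mem_image, Finset.mem_image]
    constructor
    · rintro (⟨L', h, rfl⟩ | ⟨L', h, rfl⟩)
      · rw [ih] at h
        simp only [List.map_cons, List.sum_cons, h]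
        omega
      · rw [ih] at h
        match L', h with
        | n :: L', h =>
          simp only [List.map_cons, List.sum_cons, incHead] at h ⊢
          omega
    · intro h
      match L, h with
      | 0 :: L, h =>
        refine Or.inl ⟨L, ih.2 ?_, rfl⟩
        simp only [List.map_cons, List.sum_cons] at h
        omega
      | (n + 1) :: L, h =>
        refine Or.inr ⟨n :: L, ih.2 ?_, rfl⟩
        simp only [List.map_cons, List.sum_cons] at h ⊢
        omega

theorem ne_nil_of_mem_compositionLists {N : ℕ} {L : List ℕ} (h : L ∈ compositionLists N) :
    L ≠ [] := by
  rintro rfl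
  simp [mem_compositionLists] at h

theorem sum_compositionLists_succ {R : Type*} [AddCommMonoid R] (N : ℕ) (h : List ℕ → R) :
    ∑ L ∈ compositionLists (N + 1), h L
      = ∑ L ∈ compositionLists N, (h (0 :: L) + h (incHead L)) := by
  rw [compositionLists, Finset.sum_union, Finset.sum_image, Finset.sum_image,
    Finset.sum_add_distrib]
  · intro L hL L' hL' hLL
    match L, L', ne_nil_of_mem_compositionLists hL, ne_nil_of_mem_compositionLists hL', hLL with
    | n :: L, n' :: L', _, _, hLL =>
      simpa [incHead] using hLL
  · intro L _ L' _ hLL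
    simpa using hLL
  · rw [Finset.disjoint_left]
    intro L hL hL'
    obtain ⟨K, -, rfl⟩ := Finset.mem_image.1 hL
    obtain ⟨K', hK', hKK⟩ := Finset.mem_image.1 hL'
    match K', ne_nil_of_mem_compositionLists hK', hKK with
    | n :: K', _, hKK => simp [incHead] at hKK

/-- The number of proper initial segments of the blocks with fewer than `x` elements in total. -/
def initialCount : List ℕ → ℕ → ℕ
  | [], _ => 0
  | n :: L, x => (if 0 < x then 1 else 0) + initialCount L (x - (n + 1))

theorem initialCount_zero (L : List ℕ) : initialCount L 0 = 0 := by
  induction L with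
  | nil => rfl
  | cons n L ih => simp [initialCount, ih]

theorem initialCount_one {L : List ℕ} (h : L ≠ []) : initialCount L 1 = 1 := by
  cases L with
  | nil => exact absurd rfl h
  | cons n L => simp [initialCount, initialCount_zero]

theorem nonleaderProdList_zero_cons (L : List ℕ) (i : ℤ) :
    nonleaderProdList (0 :: L) i = nonleaderProdList L (i - 1) := by
  simp [nonleaderProdList]

/-- The new last position is a nonleader with factor 1 - i; all others move one step from the end,
which replaces i by i - 1. -/
theorem nonleaderProdList_incHead {L : List ℕ} (h : L ≠ []) (i : ℤ) :
    nonleaderProdList (incHead L) i = (1 - i) * nonleaderProdList L (i - 1) := by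
  cases L with
  | nil => exact absurd rfl h
  | cons n L =>
    rw [incHead, nonleaderProdList, nonleaderProdList, Finset.prod_range_succ']
    have h1 : ∀ y ∈ Finset.range n, (((y + 1 : ℕ) : ℤ) + 1 - i) = (y : ℤ) + 1 - (i - 1) :=
      fun y _ => by push_cast; ring
    rw [Finset.prod_congr rfl h1, show i - (((n + 1 : ℕ) : ℤ) + 1) = i - 1 - ((n : ℤ) + 1) by
      push_cast; ring]
    push_cast
    ring

theorem length_incHead (L : List ℕ) : (incHead L).length = L.length := by
  cases L <;> rfl

/-- The argument on the left must be at least 2: at 1 the empty segment would be counted on the left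
only. -/
theorem initialCount_incHead (L : List ℕ) (x : ℕ) :
    initialCount (incHead L) (x + 2) = initialCount L (x + 1) := by
  cases L with
  | nil => rfl
  | cons n L => simp [incHead, initialCount]

theorem initialCount_zero_cons (L : List ℕ) (x : ℕ) :
    initialCount (0 :: L) (x + 2) = initialCount L (x + 1) + 1 := by
  simp [initialCount, add_comm]

/-- A composition amounts to a choice of nonleaders among positions 1, …, N from the end, since
position N + 1 holds a leader. The induction decides position 1. -/
theorem sum_nonleaderProdList_length (N : ℕ) (k i : ℤ) :
    ∑ L ∈ compositionLists N, (if (L.length : ℤ) = k then nonleaderProdList L i else 0)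
      = intervalESymm (1 - i) (N - i) (N - (k - 1)) := by
  induction N generalizing k i with
  | zero =>
    rw [intervalESymm_of_lt (by push_cast; omega), compositionLists, Finset.sum_singleton]
    simp only [nonleaderProdList, List.length_singleton, Finset.range_zero, Finset.prod_empty,
      mul_one]
    congr 1
    simp only [eq_iff_iff]
    push_cast
    omega
  | succ N ih =>
    rw [sum_compositionLists_succ, Finset.sum_add_distrib, intervalESymm_rec (by push_cast; omega)]
    have e1 : ((N + 1 : ℕ) : ℤ) - i = (N : ℤ) - (i - 1) := by push_cast; ring
    have e2 : ((N + 1 : ℕ) : ℤ) - (k - 1) = (N : ℤ) - ((k - 1) - 1) := by push_cast; ring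
    have e3 : (N : ℤ) - ((k - 1) - 1) - 1 = (N : ℤ) - (k - 1) := by ring
    have e4 : 1 - i + 1 = 1 - (i - 1) := by ring
    rw [e2, e3, e1, e4, ← ih, ← ih, Finset.mul_sum]
    congr 1
    · refine Finset.sum_congr rfl fun L _ => ?_
      rw [nonleaderProdList_zero_cons, List.length_cons]
      refine if_congr ?_ rfl rfl
      push_cast
      omega
    · refine Finset.sum_congr rfl fun L hL => ?_
      rw [nonleaderProdList_incHead (ne_nil_of_mem_compositionLists hL), length_incHead, mul_ite,
        mul_zero]

/-- The induction on `y` decides the positions up to `y`, whose leaders determine `initialCount`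
(offset by 1 for the empty segment). At y = 0 the remaining positions fall under
`sum_nonleaderProdList_length`. -/
theorem sum_nonleaderProdList (y l : ℕ) (k m i : ℤ) :
    ∑ L ∈ compositionLists (y + l), (if (L.length : ℤ) = k ∧ (initialCount L (y + 1) : ℤ) = m
        then nonleaderProdList L i else 0)
      = intervalESymm (1 - i) (y - i) (y + 1 - m)
        * intervalESymm (y + 1 - i) (y + l - i) (l - (k - m)) := by
  induction y generalizing k m i with
  | zero =>
    rw [intervalESymm_of_lt (by push_cast; omega)]
    by_cases hm : m = 1
    · subst hm
      have h1 := sum_nonleaderProdList_length l k i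
      simp only [zero_add, Nat.cast_zero, sub_self, if_true, one_mul]
      rw [← h1]
      refine Finset.sum_congr rfl fun L hL => ?_
      rw [initialCount_one (ne_nil_of_mem_compositionLists hL)]
      simp
    · rw [if_neg (by push_cast; omega), zero_mul]
      refine Finset.sum_eq_zero fun L hL => ?_
      rw [zero_add, initialCount_one (ne_nil_of_mem_compositionLists (N := 0 + l) hL), if_neg]
      rintro ⟨-, h⟩
      exact hm (by rw [← h]; rfl)
  | succ y ih =>
    rw [show y + 1 + l = y + l + 1 by ring, sum_compositionLists_succ, Finset.sum_add_distrib,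
      intervalESymm_rec (by push_cast; omega)]
    have e1 : ((y + 1 : ℕ) : ℤ) - i = (y : ℤ) - (i - 1) := by push_cast; ring
    have e2 : ((y + 1 : ℕ) : ℤ) + 1 - m = (y : ℤ) + 1 - (m - 1) := by push_cast; ring
    have e3 : (y : ℤ) + 1 - (m - 1) - 1 = (y : ℤ) + 1 - m := by ring
    have e4 : 1 - i + 1 = 1 - (i - 1) := by ring
    have e5 : ((y + 1 : ℕ) : ℤ) + 1 - i = (y : ℤ) + 1 - (i - 1) := by push_cast; ring
    have e6 : ((y + 1 : ℕ) : ℤ) + l - i = (y : ℤ) + l - (i - 1) := by push_cast; ring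
    have h1 := ih (k - 1) (m - 1) (i - 1)
    rw [show k - 1 - (m - 1) = k - m by ring] at h1
    rw [e2, e3, e1, e4, e5, e6, add_mul, ← h1, mul_assoc, ← ih k m (i - 1), Finset.mul_sum]
    congr 1
    · refine Finset.sum_congr rfl fun L _ => ?_
      rw [nonleaderProdList_zero_cons, List.length_cons, initialCount_zero_cons]
      refine if_congr ?_ rfl rfl
      push_cast
      omega
    · refine Finset.sum_congr rfl fun L hL => ?_
      rw [nonleaderProdList_incHead (ne_nil_of_mem_compositionLists hL), length_incHead,
        initialCount_incHead, mul_ite, mul_zero]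

/-- Pass to complements: the first j blocks have more than l elements exactly when the blocks after
them have fewer than `C.sum - l`. -/
theorem card_filter_lt_sum_take (C : List ℕ) (hC : ∀ c ∈ C, 0 < c) (l : ℕ) :
    ((Finset.Icc 1 C.length).filter fun j => l < (C.take j).sum).card
      = initialCount (C.map (· - 1)).reverse (C.sum - l) := by
  induction C using List.reverseRecOn with
  | nil => simp [initialCount]
  | append_singleton C c ih =>
    have hc : 0 < c := hC c (by simp)
    have h1 := ih fun x hx => hC x (by simp [hx])
    rw [List.map_append, List.reverse_append, List.length_append, List.sum_append]
    simp only [List.length_singleton, List.map_cons, List.map_nil, List.reverse_singleton,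
      List.singleton_append, initialCount, List.sum_singleton]
    rw [← Finset.insert_Icc_right_eq_Icc_add_one (by omega), Finset.filter_insert,
      show C.sum + c - l - (c - 1 + 1) = C.sum - l by omega, ← h1]
    have h2 : (Finset.Icc 1 C.length).filter (fun j => l < ((C ++ [c]).take j).sum)
        = (Finset.Icc 1 C.length).filter fun j => l < (C.take j).sum := by
      refine Finset.filter_congr fun j hj => ?_
      rw [List.take_append_of_le_length (Finset.mem_Icc.1 hj).2]
    have h3 : ((C ++ [c]).take (C.length + 1)).sum = C.sum + c := by
      rw [List.take_of_length_le (by simp)]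
      simp
    rw [h2, h3]
    by_cases hl : l < C.sum + c
    · rw [if_pos hl, if_pos (by omega), Finset.card_insert_of_notMem (by simp), add_comm]
    · rw [if_neg hl, if_neg (by omega), zero_add]

/-! ### Forests with given block sizes as fillings of positions -/

theorem length_filter_ofFn {β : Type*} {m : ℕ} (f : Fin m → β) (p : β → Bool) :
    ((List.ofFn f).filter p).length = (Finset.univ.filter fun i => p (f i) = true).card := by
  induction m with
  | zero => simp
  | succ m ih =>
    rw [List.ofFn_succ, Fin.card_filter_univ_succ, List.filter_cons]
    split_ifs with h <;> simp [ih]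

namespace OrderedChainForest

theorem length_flatMap_elems {s : ℕ} (F : OrderedChainForest s) :
    (F.blocks.flatMap ChainBlock.elems).length = s := by
  have h := List.toFinset_card_of_nodup F.nodup
  have h2 : (F.blocks.flatMap ChainBlock.elems).toFinset = Finset.univ := by
    ext x
    simpa using F.covers x
  rw [← h, h2, Finset.card_univ, Fintype.card_fin]

theorem sum_size {s : ℕ} (F : OrderedChainForest s) : (F.blocks.map ChainBlock.size).sum = s := by
  conv_rhs => rw [← F.length_flatMap_elems, List.length_flatMap]
  rfl

end OrderedChainForest

theorem ChainBlock.size_pos {s : ℕ} (B : ChainBlock s) : 0 < B.size :=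
  List.length_pos_iff.2 B.ne_nil

section Word

variable {s k : ℕ} (c : Fin k → ℕ)

/-- The forest with block sizes `c j + 1` whose entry at each position is prescribed. -/
def forestOfEquiv (e : (Σ j : Fin k, Fin (c j + 1)) ≃ Fin s) : OrderedChainForest s where
  blocks := List.ofFn fun j => ⟨List.ofFn fun i => e ⟨j, i⟩, by simp⟩
  nodup := by
    rw [List.nodup_flatMap]
    constructor
    · intro B hB
      obtain ⟨j, rfl⟩ := (List.mem_ofFn' _ _).1 hB
      refine List.nodup_ofFn.2 fun i i' h => ?_
      simpa using e.injective h
    · rw [List.pairwise_ofFn]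
      intro j j' hj
      simp only [Function.onFun]
      rw [List.disjoint_left]
      intro x hx hx'
      obtain ⟨i, rfl⟩ := (List.mem_ofFn' _ _).1 hx
      obtain ⟨i', h⟩ := (List.mem_ofFn' _ _).1 hx'
      exact hj.ne' (congrArg Sigma.fst (e.injective h))
  covers := by
    intro x
    rw [List.mem_flatMap]
    refine ⟨_, (List.mem_ofFn' _ _).2 ⟨(e.symm x).1, rfl⟩, ?_⟩
    exact (List.mem_ofFn' _ _).2 ⟨(e.symm x).2, by simp⟩

theorem forestOfEquiv_injective :
    Function.Injective (forestOfEquiv c : _ → OrderedChainForest s) := by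
  intro e e' h
  have h1 := List.ofFn_injective (congrArg OrderedChainForest.blocks h)
  ext ⟨j, i⟩
  have h2 := congrFun (List.ofFn_injective (congrArg ChainBlock.elems (congrFun h1 j))) i
  rw [h2]

theorem map_size_forestOfEquiv (e : (Σ j : Fin k, Fin (c j + 1)) ≃ Fin s) :
    (forestOfEquiv c e).blocks.map ChainBlock.size = List.ofFn fun j => c j + 1 := by
  simp only [forestOfEquiv, List.map_ofFn]
  congr 1
  funext j
  simp [ChainBlock.size]

theorem exists_forestOfEquiv (F : OrderedChainForest s)
    (hF : F.blocks.map ChainBlock.size = List.ofFn fun j => c j + 1) :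
    ∃ e, forestOfEquiv c e = F := by
  have hk : F.blocks.length = k := by simpa using congrArg List.length hF
  subst hk
  have hc : ∀ j : Fin F.blocks.length, (F.blocks[j]).elems.length = c j + 1 := by
    intro j
    have h1 : (F.blocks.map ChainBlock.size)[(j : ℕ)]? = some (c j + 1) := by
      rw [hF]
      simp
    simpa [ChainBlock.size] using h1
  let v : (Σ j : Fin F.blocks.length, Fin (c j + 1)) → Fin s :=
    fun p => (F.blocks[p.1]).elems[(p.2 : ℕ)]'(by rw [hc]; exact p.2.2)
  have hsurj : Function.Surjective v := by
    intro x
    obtain ⟨B, hB, hx⟩ := List.mem_flatMap.1 (F.covers x)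
    obtain ⟨j, hj, rfl⟩ := List.getElem_of_mem hB
    obtain ⟨i, hi, rfl⟩ := List.getElem_of_mem hx
    exact ⟨⟨⟨j, hj⟩, ⟨i, by rw [← hc]; exact hi⟩⟩, rfl⟩
  have hcard : Fintype.card (Σ j : Fin F.blocks.length, Fin (c j + 1)) = Fintype.card (Fin s) := by
    have h1 := F.sum_size
    rw [hF, List.sum_ofFn] at h1
    simpa using h1
  have hbij : Function.Bijective v :=
    (Fintype.bijective_iff_surjective_and_card v).2 ⟨hsurj, hcard⟩
  refine ⟨Equiv.ofBijective v hbij, ?_⟩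
  refine OrderedChainForest.ext (List.ext_getElem (by simp [forestOfEquiv]) fun j h1 h2 => ?_)
  simp only [forestOfEquiv, List.getElem_ofFn]
  refine ChainBlock.ext (List.ext_getElem ?_ fun i h3 h4 => ?_)
  · simp only [List.length_ofFn]
    exact (hc ⟨j, h2⟩).symm
  · exact List.getElem_ofFn _

/-- The block of a position. -/
def positionBlock (p : Σ j : Fin k, Fin (c j + 1)) : Fin k := p.1

/-- The position of the leader of a block. -/
def leaderPosition (j : Fin k) : Σ j : Fin k, Fin (c j + 1) := ⟨j, 0⟩

variable {c}

theorem mk_eq_leaderPosition {j : Fin k} {i : Fin (c j + 1)} :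
    (⟨j, i⟩ : Σ j : Fin k, Fin (c j + 1)) = leaderPosition c j ↔ i = 0 :=
  ⟨fun h => eq_of_heq (Sigma.mk.inj h).2, fun h => by rw [h]; rfl⟩

theorem leader_forestOfEquiv (e : (Σ j : Fin k, Fin (c j + 1)) ≃ Fin s) (j : Fin k)
    (h : (List.ofFn fun i => e ⟨j, i⟩) ≠ []) :
    (⟨List.ofFn fun i => e ⟨j, i⟩, h⟩ : ChainBlock s).leader = e ⟨j, 0⟩ := by
  simp [ChainBlock.leader, List.ofFn_succ]

theorem naturallyOrdered_forestOfEquiv (e : (Σ j : Fin k, Fin (c j + 1)) ≃ Fin s) :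
    (forestOfEquiv c e).NaturallyOrdered
      ↔ ∀ j : Fin k, ∀ j' < j, e (leaderPosition c j') < e (leaderPosition c j) := by
  simp only [OrderedChainForest.NaturallyOrdered, forestOfEquiv, List.pairwise_ofFn,
    leader_forestOfEquiv, leaderPosition]
  exact ⟨fun h j j' hj => h hj, fun h j j' hj => h _ _ hj⟩

theorem weight_forestOfEquiv (e : (Σ j : Fin k, Fin (c j + 1)) ≃ Fin s) :
    (forestOfEquiv c e).weight
      = ∑ j, (Finset.univ.filter fun i : Fin (c j) => e ⟨j, i.succ⟩ < e ⟨j, 0⟩).card := by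
  rw [OrderedChainForest.weight, forestOfEquiv, List.map_ofFn, List.sum_ofFn]
  refine Finset.sum_congr rfl fun j _ => ?_
  simp only [Function.comp, ChainBlock.weight, leader_forestOfEquiv]
  rw [length_filter_ofFn, Fin.card_filter_univ_succ]
  simp

-- Each leader gives 1 - X, or 0 if some earlier leader is larger; each nonleader smaller than its
-- leader gives X.
open Polynomial in
open Classical in
theorem prod_fillWeight (e : (Σ j : Fin k, Fin (c j + 1)) ≃ Fin s) :
    ∏ p, fillWeight (positionBlock c) (leaderPosition c) p
        (Finset.univ.filter fun p' => e p' < e p)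
      = if (forestOfEquiv c e).NaturallyOrdered
        then (1 - X) ^ k * X ^ (forestOfEquiv c e).weight else 0 := by
  rw [Fintype.prod_sigma]
  have h1 : ∀ j : Fin k, ∏ i : Fin (c j + 1),
      fillWeight (positionBlock c) (leaderPosition c) ⟨j, i⟩
        (Finset.univ.filter fun p' => e p' < e ⟨j, i⟩)
      = (if ∀ j' < j, e (leaderPosition c j') < e (leaderPosition c j) then 1 - X else 0)
        * X ^ (Finset.univ.filter fun i : Fin (c j) => e ⟨j, i.succ⟩ < e ⟨j, 0⟩).card := by
    intro j
    rw [Fin.prod_univ_succ]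
    congr 1
    · have hl : (⟨j, 0⟩ : Σ j : Fin k, Fin (c j + 1))
          = leaderPosition c (positionBlock c ⟨j, 0⟩) := rfl
      rw [fillWeight, if_pos hl]
      refine if_congr ?_ rfl rfl
      simp only [Finset.mem_filter, Finset.mem_univ, true_and]
      rfl
    · rw [← Finset.prod_const, Finset.prod_filter]
      refine Finset.prod_congr rfl fun i _ => ?_
      have hne : e ⟨j, i.succ⟩ ≠ e ⟨j, 0⟩ := fun h => by
        simpa using e.injective h
      have hmem : leaderPosition c (positionBlock c ⟨j, i.succ⟩)
          ∈ (Finset.univ.filter fun p' => e p' < e ⟨j, i.succ⟩) ↔ e ⟨j, 0⟩ < e ⟨j, i.succ⟩ := by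
        simp only [Finset.mem_filter, Finset.mem_univ, true_and]
        rfl
      have hl : ¬ (⟨j, i.succ⟩ : Σ j : Fin k, Fin (c j + 1))
          = leaderPosition c (positionBlock c ⟨j, i.succ⟩) :=
        fun h => Fin.succ_ne_zero i (mk_eq_leaderPosition.1 h)
      rw [fillWeight, if_neg hl]
      rcases lt_or_gt_of_ne hne with h | h
      · rw [if_neg (hmem.not.2 h.not_gt), if_pos h]
      · rw [if_pos (hmem.2 h), if_neg h.not_gt]
  rw [Finset.prod_congr rfl fun j _ => h1 j, Finset.prod_mul_distrib, Finset.prod_pow_eq_pow_sum,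
    ← weight_forestOfEquiv]
  split_ifs with h
  · rw [naturallyOrdered_forestOfEquiv] at h
    rw [Finset.prod_congr rfl fun j _ => if_pos (h j), Finset.prod_const]
    simp
  · rw [naturallyOrdered_forestOfEquiv] at h
    push Not at h
    obtain ⟨j, j', hj, hjj⟩ := h
    rw [Finset.prod_eq_zero (Finset.mem_univ j), zero_mul]
    rw [if_neg]
    exact fun hall => absurd (hall j' hj) (not_lt.2 hjj)

theorem nonleaderCount_univ (j : Fin k) :
    nonleaderCount (positionBlock c) (leaderPosition c) Finset.univ j = c j := by
  rw [nonleaderCount]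
  conv_rhs => rw [← Fintype.card_fin (c j), ← Finset.card_univ]
  symm
  refine Finset.card_bij (fun i _ => ⟨j, i.succ⟩) ?_ ?_ ?_
  · intro i _
    exact Finset.mem_filter.2 ⟨Finset.mem_univ _, rfl,
      fun h => Fin.succ_ne_zero i (mk_eq_leaderPosition.1 h)⟩
  · intro i _ i' _ h
    simpa using h
  · rintro ⟨j', i⟩ h
    obtain ⟨-, h1, h2⟩ := Finset.mem_filter.1 h
    obtain rfl : j' = j := Fin.ext h1
    have hi : i ≠ 0 := fun hi => h2 (mk_eq_leaderPosition.2 hi)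
    exact ⟨i.pred hi, Finset.mem_univ _, by simp⟩

end Word

/-! ### Coefficient extraction and summation over block sizes -/

noncomputable instance (s : ℕ) : Fintype (OrderedChainForest s) := Fintype.ofFinite _

open Polynomial Nat in
open Classical in
/-- The weight enumerator of the naturally ordered forests with prescribed block sizes. -/
theorem sum_forests_of_sizes {k : ℕ} (n : ℕ → ℕ) :
    ∑ F : OrderedChainForest (blockTotal n k) with F.NaturallyOrdered
        ∧ F.blocks.map ChainBlock.size = List.ofFn fun j : Fin k => n j + 1,
      (1 - X : ℚ[X]) ^ k * X ^ F.weight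
      = ((blockTotal n k)! : ℚ[X]) * leaderPoly n k := by
  have hcard : Fintype.card (Σ j : Fin k, Fin (n j + 1)) = blockTotal n k := by
    simp [blockTotal, Finset.sum_range]
  have h := sum_prod_fillWeight (b := positionBlock fun j : Fin k => n j)
    (lead := leaderPosition fun j : Fin k => n j) (fun j => rfl) _ hcard
  rw [leaderPoly_congr (n' := n) fun j hj =>
    nonleaderCount_univ (c := fun j : Fin k => n j) ⟨j, hj⟩] at h
  rw [← h]
  simp only [prod_fillWeight]
  rw [← Finset.sum_filter]
  symm
  refine Finset.sum_bij (fun e _ => forestOfEquiv _ e) ?_ ?_ ?_ ?_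
  · intro e he
    simp only [Finset.mem_filter, Finset.mem_univ, true_and] at he ⊢
    exact ⟨he, map_size_forestOfEquiv _ e⟩
  · intro e _ e' _ hee
    exact forestOfEquiv_injective _ hee
  · intro F hF
    simp only [Finset.mem_filter, Finset.mem_univ, true_and] at hF
    obtain ⟨e, rfl⟩ := exists_forestOfEquiv (fun j : Fin k => n j) F hF.2
    exact ⟨e, by simpa using hF.1, rfl⟩
  · intro e _
    rfl

/-- Divide by (1-X)^(k+1) as power series. -/
theorem coeff_eq_of_one_sub_X_pow_mul {A B : Polynomial ℚ} {k : ℕ}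
    (h : (1 - Polynomial.X) ^ (k + 1) * A = B) (q : ℕ) :
    A.coeff q = ∑ i ∈ Finset.range (q + 1), B.coeff i * ((k + (q - i)).choose k : ℚ) := by
  have h1 : (1 - PowerSeries.X : PowerSeries ℚ) ^ (k + 1) * (A : PowerSeries ℚ) = B := by
    rw [← h]
    simp
  have h2 : (A : PowerSeries ℚ)
      = (B : PowerSeries ℚ) * PowerSeries.mk fun j => ((k + j).choose k : ℚ) := by
    rw [← PowerSeries.mk_one_pow_eq_mk_choose_add, ← h1, mul_right_comm, ← mul_pow,
      mul_comm (1 - PowerSeries.X), PowerSeries.mk_one_mul_one_sub_eq_one, one_pow, one_mul]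
  rw [← Polynomial.coeff_coe, h2, PowerSeries.coeff_mul,
    Finset.Nat.sum_antidiagonal_eq_sum_range_succ_mk]
  simp [PowerSeries.coeff_mk]

open Classical in
theorem card_forests_of_sizes {s k : ℕ} (n : ℕ → ℕ) (hs : blockTotal n (k + 1) = s) (q : ℕ) :
    ((Finset.univ.filter fun F : OrderedChainForest s => (F.NaturallyOrdered
        ∧ F.blocks.map ChainBlock.size = List.ofFn fun j : Fin (k + 1) => n j + 1)
        ∧ F.weight = q).card : ℤ)
      = ∑ i ∈ Finset.range (q + 1), (-1 : ℤ) ^ i * (s.choose i : ℤ) * nonleaderProd n (k + 1) i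
          * ((k + (q - i)).choose k : ℤ) := by
  subst hs
  have h := sum_forests_of_sizes (k := k + 1) n
  rw [← Finset.mul_sum] at h
  have h2 := coeff_eq_of_one_sub_X_pow_mul h q
  rw [Polynomial.finsetSum_coeff] at h2
  simp only [Polynomial.coeff_X_pow, Polynomial.coeff_natCast_mul, coeff_leaderPoly,
    leaderCoeff_mul_factorial, eq_comm (a := q)] at h2
  rw [Finset.sum_boole, Finset.filter_filter] at h2
  exact_mod_cast h2

namespace OrderedChainForest

/-- The numbers of elements besides the leader in the blocks, the last block first. -/
def nonleaderSizes {s : ℕ} (F : OrderedChainForest s) : List ℕ :=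
  ((F.blocks.map ChainBlock.size).map (· - 1)).reverse

theorem length_nonleaderSizes {s : ℕ} (F : OrderedChainForest s) :
    F.nonleaderSizes.length = F.numBlocks := by
  simp [nonleaderSizes, numBlocks]

theorem map_size_eq {s : ℕ} (F : OrderedChainForest s) :
    F.blocks.map ChainBlock.size = F.nonleaderSizes.reverse.map (· + 1) := by
  rw [nonleaderSizes, List.reverse_reverse, List.map_map, List.map_map]
  refine List.map_congr_left fun B _ => ?_
  exact (Nat.sub_add_cancel B.size_pos).symm

theorem gamma_eq {s : ℕ} (F : OrderedChainForest s) (l : ℕ) :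
    F.gamma l = initialCount F.nonleaderSizes (s - l) := by
  have h := card_filter_lt_sum_take (F.blocks.map ChainBlock.size)
    (fun c hc => by
      obtain ⟨B, -, rfl⟩ := List.mem_map.1 hc
      exact B.size_pos) l
  rw [F.sum_size, List.length_map] at h
  simp only [← List.map_take] at h
  exact h

theorem map_size_eq_ofFn_iff {s k : ℕ} (F : OrderedChainForest s) {L : List ℕ}
    (hL : L.length = k) :
    F.blocks.map ChainBlock.size = (List.ofFn fun j : Fin k => L.reverse.getD j 0 + 1)
      ↔ F.nonleaderSizes = L := by
  have h1 : (List.ofFn fun j : Fin k => L.reverse.getD j 0 + 1) = L.reverse.map (· + 1) := by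
    refine List.ext_getElem (by simp [hL]) fun j h2 h3 => ?_
    have h4 : j < L.reverse.length := by simpa using h3
    simp only [List.getElem_ofFn, List.getElem_map]
    rw [List.getD_eq_getElem _ _ h4]
  rw [h1, map_size_eq]
  constructor
  · intro h
    exact List.reverse_injective (List.map_injective_iff.2 (add_left_injective 1) h)
  · rintro rfl
    rfl

end OrderedChainForest

theorem map_getD_reverse {L : List ℕ} {k : ℕ} (hL : L.length = k) :
    ((List.range k).map fun j => L.reverse.getD j 0).reverse = L := by
  rw [List.reverse_eq_iff]
  refine List.ext_getElem (by simp [hL]) fun j h1 h2 => ?_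
  rw [List.getElem_map, List.getElem_range, List.getD_eq_getElem _ _ h2]

theorem blockTotal_getD_reverse {L : List ℕ} {k : ℕ} (hL : L.length = k) :
    blockTotal (fun j => L.reverse.getD j 0) k = (L.map (· + 1)).sum := by
  conv_rhs => rw [← map_getD_reverse hL, List.map_reverse, List.sum_reverse, List.map_map]
  rw [blockTotal, Finset.sum_range, ← List.sum_ofFn, List.ofFn_eq_map,
    ← List.map_coe_finRange_eq_range,
    List.map_map]
  rfl

-- The list of block sizes determines both the number of blocks and γ, so the set is a union of
-- fibres counted by `card_forests_of_sizes`.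
open Classical in
theorem ncard_CF_eq_sum (q y l k m : ℕ) :
    ((CF q (y + l + 1) (k + 1) l m).ncard : ℤ)
      = ∑ L ∈ (compositionLists (y + l)).filter
          (fun L => L.length = k + 1 ∧ initialCount L (y + 1) = m),
        ∑ i ∈ Finset.range (q + 1), (-1 : ℤ) ^ i * ((y + l + 1).choose i : ℤ)
          * nonleaderProdList L i * ((k + (q - i)).choose k : ℤ) := by
  have hset : CF q (y + l + 1) (k + 1) l m
      = (Finset.univ.filter fun F : OrderedChainForest (y + l + 1) =>
        F.NaturallyOrdered ∧ F.numBlocks = k + 1 ∧ F.weight = q ∧ F.gamma l = m) := by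
    ext F
    simp [CF]
  have hsub : y + l + 1 - l = y + 1 := by omega
  rw [hset, Set.ncard_coe_finset, Finset.card_eq_sum_card_fiberwise
    (f := OrderedChainForest.nonleaderSizes)
    (t := (compositionLists (y + l)).filter
      (fun L => L.length = k + 1 ∧ initialCount L (y + 1) = m))]
  · push_cast
    refine Finset.sum_congr rfl fun L hL => ?_
    obtain ⟨hL1, hL2, hL3⟩ := Finset.mem_filter.1 hL
    rw [mem_compositionLists] at hL1
    have h := card_forests_of_sizes (s := y + l + 1) (fun j => L.reverse.getD j 0)
      (by rw [blockTotal_getD_reverse hL2, hL1]) q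
    simp only [nonleaderProd_eq_list, map_getD_reverse hL2] at h
    rw [← h]
    congr 2
    ext F
    simp only [Finset.mem_filter, Finset.mem_univ, true_and,
      OrderedChainForest.map_size_eq_ofFn_iff F hL2]
    constructor
    · rintro ⟨⟨h1, h2, h3, h4⟩, h5⟩
      exact ⟨⟨h1, h5⟩, h3⟩
    · rintro ⟨⟨h1, rfl⟩, h3⟩
      refine ⟨⟨h1, ?_, h3, ?_⟩, rfl⟩
      · rw [← F.length_nonleaderSizes, hL2]
      · rw [F.gamma_eq, hsub, hL3]
  · intro F hF
    obtain ⟨-, h1, h2, h3, h4⟩ := Finset.mem_filter.1 hF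
    rw [F.gamma_eq, hsub] at h4
    refine Finset.mem_filter.2 ⟨?_, by rw [F.length_nonleaderSizes, h2], h4⟩
    rw [mem_compositionLists, ← List.sum_reverse, ← List.map_reverse, ← F.map_size_eq, F.sum_size]

/-- The number of naturally ordered chain forests of `[s]` with `k` blocks, weight `q` and
`γ(F, l) = m`, as an alternating sum. -/
theorem mainTheorem3 (q s k l m : ℕ) (hm : 1 ≤ m) (hmk : m ≤ k) (hks : k ≤ s)
    (hl : l ≤ s - 1) :
    ((CF q s k l m).ncard : ℤ) =
      ∑ i ∈ Finset.range (q + 1),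
        (-1 : ℤ) ^ i * (s.choose i : ℤ)
          * intervalESymm (-(i : ℤ) + 1) ((s : ℤ) - 1 - l - i) ((s : ℤ) - l - m)
          * intervalESymm ((s : ℤ) - l - i) ((s : ℤ) - 1 - i) ((l : ℤ) - ((k : ℤ) - m))
          * ((k - 1 + (q - i)).choose (k - 1) : ℤ) := by
  -- Here y = s - 1 - ℓ, the right end of the first interval at i = 0; y + 1 = s - ℓ is the
  -- threshold in `initialCount`.
  obtain ⟨y, rfl⟩ : ∃ y, s = y + l + 1 := ⟨s - 1 - l, by omega⟩
  obtain ⟨k, rfl⟩ : ∃ k', k = k' + 1 := ⟨k - 1, by omega⟩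
  rw [ncard_CF_eq_sum, Finset.sum_comm]
  refine Finset.sum_congr rfl fun i _ => ?_
  have h := sum_nonleaderProdList y l ((k + 1 : ℕ) : ℤ) m i
  simp only [Nat.cast_inj] at h
  rw [← Finset.sum_filter] at h
  rw [← Finset.sum_mul, ← Finset.mul_sum, h, Nat.add_sub_cancel,
    show -(i : ℤ) + 1 = 1 - i by ring,
    show ((y + l + 1 : ℕ) : ℤ) - 1 - l - i = y - i by push_cast; ring,
    show ((y + l + 1 : ℕ) : ℤ) - l - m = y + 1 - m by push_cast; ring,
    show ((y + l + 1 : ℕ) : ℤ) - l - i = y + 1 - i by push_cast; ring,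
    show ((y + l + 1 : ℕ) : ℤ) - 1 - i = y + l - i by push_cast; ring]
  ring
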